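/- Let $1<\alpha\le 2$, $|\theta|\le\min\{\alpha,2-\alpha\}$, and let $f\in C^1(\mathbb{R})$ satisfy $f(0)=f(1)=0$, $f'(0)<0$, $f'(1)<0$. For $1<\alpha<2$ let $D^\alpha_\theta$ be the Riesz–Feller operator $$D^\alpha_\theta v(x)=c_1\int_0^\infty\frac{v(x+z)-v(x)-v'(x)z}{z^{1+\alpha}}\,dz+c_2\int_0^\infty\frac{v(x-z)-v(x)+v'(x)z}{z^{1+\alpha}}\,dz,$$ $$c_1=\frac{\Gamma(1+\alpha)}{\pi}\sin\Big((\alpha+\theta)\frac{\pi}{2}\Big),\qquad c_2=\frac{\Gamma(1+\alpha)}{\pi}\sin\Big((\alpha-\theta)\frac{\pi}{2}\Big),$$ and let $D^2_0v=v''$. A pair $(U,c)$ of a function $U:\mathbb{R}\to\mathbb{R}$ and a number $c\in\mathbb{R}$ is called a traveling wave solution of $$\partial_t u=D^\alpha_\theta u+f(u),\qquad x\in\mathbb{R},\ t>0,\qquad(*)$$ connecting $0$ to $1$ if $\lim_{\xi\to-\infty}U(\xi)=0$, $\lim_{\xi\to+\infty}U(\xi)=1$, and $u(x,t)=U(x-ct)$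 satisfies $(*)$ at every point $(x,t)\in\mathbb{R}\times(0,\infty)$, where it is part of the requirement that the derivatives occurring in $(*)$ exist and that, for $\alpha<2$, both integrals converge absolutely (no continuity or boundedness of derivatives is required). **Theorem.** Let $(U,c)$ be a traveling wave solution of $(*)$ connecting $0$ to $1$ with $U\in C^1(\mathbb{R})$, $U'(\xi)>0$ for all $\xi\in\mathbb{R}$, and $\lim_{|\xi|\to\infty}U'(\xi)=0$. Then for every traveling wave solution $(\tilde U,\tilde c)$ of $(*)$ connecting $0$ to $1$ with $\tilde U\in C(\mathbb{R})$ and $0\le\tilde U\le 1$ on $\mathbb{R}$, one has $\tilde c=c$, and there is $\xi_0\in\mathbb{R}$ with $\tilde U(\xi)=U(\xi+\xi_0)$ for all $\xi\in\mathbb{R}$. -/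

import Mathlib

open Filter Topology Set MeasureTheory

noncomputable section

/-- The coefficient `c₁ = Γ(1+α) sin((α+θ)π/2) / π` of the jumps to the right. -/
def rieszFellerC₁ (α θ : ℝ) : ℝ :=
  Real.Gamma (1 + α) * Real.sin ((α + θ) * (Real.pi / 2)) / Real.pi

/-- The coefficient `c₂ = Γ(1+α) sin((α-θ)π/2) / π` of the jumps to the left. -/
def rieszFellerC₂ (α θ : ℝ) : ℝ :=
  Real.Gamma (1 + α) * Real.sin ((α - θ) * (Real.pi / 2)) / Real.pi

/-- The integrand `(v(x+z) - v(x) - v'(x) z) / z^(1+α)`, for `z > 0`. -/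
def rieszFellerRight (α : ℝ) (v : ℝ → ℝ) (x z : ℝ) : ℝ :=
  (v (x + z) - v x - deriv v x * z) / z ^ (1 + α)

/-- The integrand `(v(x-z) - v(x) + v'(x) z) / z^(1+α)`, for `z > 0`. -/
def rieszFellerLeft (α : ℝ) (v : ℝ → ℝ) (x z : ℝ) : ℝ :=
  (v (x - z) - v x + deriv v x * z) / z ^ (1 + α)

/-- The value at `x` of the Riesz-Feller operator `D^α_θ` of order `1 < α ≤ 2` and skewness `θ`
applied to `v`: the second derivative for `α = 2`, the singular integral for `1 < α < 2`. -/
def rieszFeller (α θ : ℝ) (v : ℝ → ℝ) (x : ℝ) : ℝ :=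
  if α = 2 then deriv (deriv v) x
  else rieszFellerC₁ α θ * (∫ z in Ioi (0 : ℝ), rieszFellerRight α v x z)
    + rieszFellerC₂ α θ * (∫ z in Ioi (0 : ℝ), rieszFellerLeft α v x z)

/-- `D^α_θ v (x)` is meaningful: the derivatives of `v` that enter exist, and (for `α < 2`) the two
singular integrals converge absolutely. This holds for all `x` if `v` is `C²` with bounded `v`,
`v'`, `v''`. -/
def RieszFellerDefinedAt (α : ℝ) (v : ℝ → ℝ) (x : ℝ) : Prop :=
  if α = 2 then (∀ᶠ y in 𝓝 x, DifferentiableAt ℝ v y) ∧ DifferentiableAt ℝ (deriv v) x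
  else DifferentiableAt ℝ v x ∧ IntegrableOn (rieszFellerRight α v x) (Ioi 0)
    ∧ IntegrableOn (rieszFellerLeft α v x) (Ioi 0)

/-- `u = u(x,t)` solves `∂u/∂t = D^α_θ u + f(u)` pointwise for all `x ∈ ℝ`, `t > 0`. -/
def IsRDSolution (α θ : ℝ) (f : ℝ → ℝ) (u : ℝ → ℝ → ℝ) : Prop :=
  ∀ x t : ℝ, 0 < t →
    RieszFellerDefinedAt α (fun y => u y t) x ∧
    HasDerivAt (fun s => u x s) (rieszFeller α θ (fun y => u y t) x + f (u x t)) t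

/-- `(U, c)` is a traveling wave solution connecting the different endstates `uminus` (at `-∞`) and
`uplus` (at `+∞`): `u(x,t) = U(x - ct)` is a solution. -/
structure IsTravelingWave (α θ : ℝ) (f : ℝ → ℝ) (uminus uplus : ℝ) (U : ℝ → ℝ) (c : ℝ) :
    Prop where
  solution : IsRDSolution α θ f (fun x t => U (x - c * t))
  ne : uminus ≠ uplus
  tendsto_atBot : Tendsto U atBot (𝓝 uminus)
  tendsto_atTop : Tendsto U atTop (𝓝 uplus)

/-- Bistability: `f ∈ C¹(ℝ)`, `f(0) = 0 = f(1)`, `f'(0) < 0`, `f'(1) < 0`. -/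
structure IsBistable (f : ℝ → ℝ) : Prop where
  contDiff : ContDiff ℝ 1 f
  zero : f 0 = 0
  one : f 1 = 0
  deriv_zero : deriv f 0 < 0
  deriv_one : deriv f 1 < 0

end

/-! The proof is a sliding argument. At a negative minimum of a difference `Q - P` the derivatives
agree and the operators are ordered, so a sub- and a supersolution can violate `P ≤ Q` only where
`f` fails to be strictly decreasing, hence not near the two stable states
(`le_of_subsolution_supersolution`). A translate of `U` moved far enough is therefore ordered
against `V`, and sliding it back produces a contact point (`exists_touching`).

Since `U' > 0`, translates of `U` are subsolutions for any larger speed and supersolutions for any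
smaller one. So contact occurs from below if `c ≤ c'` and from above if `c' ≤ c`; evaluating both
equations there forces equal speeds.

With equal speeds, contact for `α = 2` means equal Cauchy data for an ODE. For `α < 2` the nonlocal
terms force equality on a half-line (`eq_of_rieszFeller_le`). Contacts from below and above give two
half-lines in the same direction; on their overlap the two translates of `U` agree, so the shifts
coincide and squeeze `V`. -/

/-! ### Translation invariance and the profile equation. -/

theorem deriv_comp_translate (v : ℝ → ℝ) (a : ℝ) :
    deriv (fun y => v (y + a)) = fun x => deriv v (x + a) :=
  funext fun x => deriv_comp_add_const v a x

theorem rieszFellerRight_translate (α : ℝ) (v : ℝ → ℝ) (a x : ℝ) :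
    rieszFellerRight α (fun y => v (y + a)) x = rieszFellerRight α v (x + a) := by
  funext z
  simp only [rieszFellerRight, deriv_comp_translate, add_right_comm x z a]

theorem rieszFellerLeft_translate (α : ℝ) (v : ℝ → ℝ) (a x : ℝ) :
    rieszFellerLeft α (fun y => v (y + a)) x = rieszFellerLeft α v (x + a) := by
  funext z
  simp only [rieszFellerLeft, deriv_comp_translate, sub_add_eq_add_sub]

theorem rieszFeller_translate (α θ : ℝ) (v : ℝ → ℝ) (a x : ℝ) :
    rieszFeller α θ (fun y => v (y + a)) x = rieszFeller α θ v (x + a) := by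
  simp only [rieszFeller, rieszFellerRight_translate, rieszFellerLeft_translate,
    deriv_comp_translate v a, deriv_comp_translate (deriv v) a]

theorem differentiableAt_translate (v : ℝ → ℝ) (a x : ℝ) :
    DifferentiableAt ℝ (fun y => v (y + a)) x ↔ DifferentiableAt ℝ v (x + a) :=
  differentiableAt_comp_add_const

theorem RieszFellerDefinedAt.translate {α : ℝ} {v : ℝ → ℝ} {a x : ℝ}
    (h : RieszFellerDefinedAt α v (x + a)) :
    RieszFellerDefinedAt α (fun y => v (y + a)) x := by
  unfold RieszFellerDefinedAt at h ⊢
  split_ifs at h ⊢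
  · refine ⟨?_, ?_⟩
    · have hc : Tendsto (fun y : ℝ => y + a) (𝓝 x) (𝓝 (x + a)) :=
        (continuous_add_const a).tendsto x
      filter_upwards [hc.eventually h.1] with y hy
      exact (differentiableAt_translate v a y).2 hy
    · rw [deriv_comp_translate]
      exact (differentiableAt_translate (deriv v) a x).2 h.2
  · rw [differentiableAt_translate, rieszFellerRight_translate, rieszFellerLeft_translate]
    exact h

theorem RieszFellerDefinedAt.differentiableAt {α : ℝ} {v : ℝ → ℝ} {x : ℝ}
    (h : RieszFellerDefinedAt α v x) : DifferentiableAt ℝ v x := by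
  unfold RieszFellerDefinedAt at h
  split_ifs at h
  · exact h.1.self_of_nhds
  · exact h.1

/-- The profile of a traveling wave is in the domain of the operator at every point. -/
theorem IsTravelingWave.definedAt {α θ : ℝ} {f : ℝ → ℝ} {a b : ℝ} {U : ℝ → ℝ} {c : ℝ}
    (hU : IsTravelingWave α θ f a b U c) (ξ : ℝ) : RieszFellerDefinedAt α U ξ := by
  have h := (hU.solution (ξ + c) 1 one_pos).1
  have h' : RieszFellerDefinedAt α (fun y => (fun w => U (w - c * 1)) (y + c)) ξ := h.translate
  simpa using h'

/-- The profile of a traveling wave solves the stationary equation in the moving frame. -/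
theorem IsTravelingWave.profile {α θ : ℝ} {f : ℝ → ℝ} {a b : ℝ} {U : ℝ → ℝ} {c : ℝ}
    (hU : IsTravelingWave α θ f a b U c) (ξ : ℝ) :
    rieszFeller α θ U ξ + c * deriv U ξ + f (U ξ) = 0 := by
  -- The equation holds only for `t > 0`; at time `1` the profile point `ξ` sits at `ξ + c`.
  have h := (hU.solution (ξ + c) 1 one_pos).2
  have htr := rieszFeller_translate α θ (fun w => U (w - c * 1)) c ξ
  have hpt : ξ + c - c * 1 = ξ := by ring
  simp only [mul_one, add_sub_cancel_right] at htr h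
  have hUd : HasDerivAt U (deriv U ξ) (ξ + c - c * 1) := by
    rw [hpt]
    exact (hU.definedAt ξ).differentiableAt.hasDerivAt
  have hin : HasDerivAt (fun s : ℝ => ξ + c - c * s) (-c) 1 := by
    simpa using ((hasDerivAt_id (1 : ℝ)).const_mul c).const_sub (ξ + c)
  have h2 : HasDerivAt (fun s : ℝ => U (ξ + c - c * s)) (deriv U ξ * -c) 1 :=
    hUd.comp (1 : ℝ) hin
  have := h.unique h2
  rw [← htr] at this
  linarith

/-! ### Maximum principles for the operator. -/

/-- A negative value would make the point a local maximum too, so `h` would be locally constant. -/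
theorem deriv_deriv_nonneg_of_isLocalMin {h : ℝ → ℝ} {x : ℝ} (hmin : IsLocalMin h x)
    (hc : ContinuousAt h x) : 0 ≤ deriv (deriv h) x := by
  by_contra! hlt
  have hmax := isLocalMax_of_deriv_deriv_neg hlt hmin.deriv_eq_zero hc
  have heq : h =ᶠ[𝓝 x] fun _ => h x := by
    filter_upwards [hmin, hmax] with y h1 h2 using le_antisymm h2 h1
  have h2 := heq.deriv.deriv_eq
  simp at h2
  linarith

theorem rieszFellerC_nonneg {α : ℝ} (h1 : 1 < α) {β : ℝ} (h0 : 0 ≤ β) (h2 : β ≤ 2) :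
    0 ≤ Real.Gamma (1 + α) * Real.sin (β * (Real.pi / 2)) / Real.pi := by
  have hG : 0 < Real.Gamma (1 + α) := Real.Gamma_pos_of_pos (by linarith)
  have hpi := Real.pi_pos
  have hs : 0 ≤ Real.sin (β * (Real.pi / 2)) :=
    Real.sin_nonneg_of_nonneg_of_le_pi (by positivity) (by nlinarith)
  positivity

theorem rieszFellerC_pos {α : ℝ} (h1 : 1 < α) {β : ℝ} (h0 : 0 < β) (h2 : β < 2) :
    0 < Real.Gamma (1 + α) * Real.sin (β * (Real.pi / 2)) / Real.pi := by
  have hG : 0 < Real.Gamma (1 + α) := Real.Gamma_pos_of_pos (by linarith)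
  have hpi := Real.pi_pos
  have hs : 0 < Real.sin (β * (Real.pi / 2)) :=
    Real.sin_pos_of_pos_of_lt_pi (by positivity) (by nlinarith)
  positivity

theorem rieszFellerC₁_nonneg {α θ : ℝ} (h1 : 1 < α) (hθ : |θ| ≤ min α (2 - α)) :
    0 ≤ rieszFellerC₁ α θ := by
  have h := abs_le.1 (hθ.trans (min_le_right _ _))
  exact rieszFellerC_nonneg h1 (by linarith) (by linarith)

theorem rieszFellerC₂_nonneg {α θ : ℝ} (h1 : 1 < α) (hθ : |θ| ≤ min α (2 - α)) :
    0 ≤ rieszFellerC₂ α θ := by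
  have h := abs_le.1 (hθ.trans (min_le_right _ _))
  exact rieszFellerC_nonneg h1 (by linarith) (by linarith)

/-- At extreme skewness `θ = ±(2 - α)` one coefficient vanishes, so jumps in only one direction can
be relied on. -/
theorem rieszFellerC_pos_or_pos {α θ : ℝ} (h1 : 1 < α) (h2 : α < 2)
    (hθ : |θ| ≤ min α (2 - α)) : 0 < rieszFellerC₁ α θ ∨ 0 < rieszFellerC₂ α θ := by
  have h := abs_le.1 (hθ.trans (min_le_right _ _))
  rcases le_or_gt θ 0 with h0 | h0
  · exact .inl (rieszFellerC_pos h1 (by linarith) (by linarith))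
  · exact .inr (rieszFellerC_pos h1 (by linarith) (by linarith))

section Minimum

variable {α θ : ℝ} {P Q : ℝ → ℝ} {x : ℝ}

theorem deriv_eq_of_sub_min (hP : RieszFellerDefinedAt α P x) (hQ : RieszFellerDefinedAt α Q x)
    (hmin : ∀ y, Q x - P x ≤ Q y - P y) : deriv P x = deriv Q x := by
  have hl : IsLocalMin (fun y => Q y - P y) x := Eventually.of_forall hmin
  have h := hl.deriv_eq_zero
  rw [deriv_fun_sub hQ.differentiableAt hP.differentiableAt] at h
  linarith

theorem rieszFellerRight_le_of_sub_min (hd : deriv P x = deriv Q x)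
    (hmin : ∀ y, Q x - P x ≤ Q y - P y) {z : ℝ} (hz : 0 < z) :
    rieszFellerRight α P x z ≤ rieszFellerRight α Q x z := by
  unfold rieszFellerRight
  rw [hd]
  have := hmin (x + z)
  gcongr ?_ / _
  linarith

theorem rieszFellerLeft_le_of_sub_min (hd : deriv P x = deriv Q x)
    (hmin : ∀ y, Q x - P x ≤ Q y - P y) {z : ℝ} (hz : 0 < z) :
    rieszFellerLeft α P x z ≤ rieszFellerLeft α Q x z := by
  unfold rieszFellerLeft
  rw [hd]
  have := hmin (x - z)
  gcongr ?_ / _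
  linarith

/-- The operator is ordered at a global minimum of the difference. -/
theorem rieszFeller_le_of_sub_min (h1 : 1 < α) (hθ : |θ| ≤ min α (2 - α))
    (hP : RieszFellerDefinedAt α P x) (hQ : RieszFellerDefinedAt α Q x)
    (hmin : ∀ y, Q x - P x ≤ Q y - P y) : rieszFeller α θ P x ≤ rieszFeller α θ Q x := by
  have hd := deriv_eq_of_sub_min hP hQ hmin
  have hPd := hP.differentiableAt
  have hQd := hQ.differentiableAt
  unfold RieszFellerDefinedAt at hP hQ
  unfold rieszFeller
  split_ifs at hP hQ ⊢ with h2
  · have hl : IsLocalMin (fun y => Q y - P y) x := Eventually.of_forall hmin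
    have h := deriv_deriv_nonneg_of_isLocalMin hl (hQd.sub hPd).continuousAt
    have he : deriv (fun y => Q y - P y) =ᶠ[𝓝 x] fun y => deriv Q y - deriv P y := by
      filter_upwards [hP.1, hQ.1] with y h1 h2 using deriv_fun_sub h2 h1
    rw [he.deriv_eq, deriv_fun_sub hQ.2 hP.2] at h
    linarith
  · have hR := setIntegral_mono_on hP.2.1 hQ.2.1 measurableSet_Ioi
      fun z hz => rieszFellerRight_le_of_sub_min hd hmin hz
    have hL := setIntegral_mono_on hP.2.2 hQ.2.2 measurableSet_Ioi
      fun z hz => rieszFellerLeft_le_of_sub_min hd hmin hz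
    exact add_le_add (mul_le_mul_of_nonneg_left hR (rieszFellerC₁_nonneg h1 hθ))
      (mul_le_mul_of_nonneg_left hL (rieszFellerC₂_nonneg h1 hθ))

theorem continuousOn_rieszFellerRight (hP : Continuous P) :
    ContinuousOn (rieszFellerRight α P x) (Ioi 0) := by
  unfold rieszFellerRight
  refine ContinuousOn.div (by fun_prop) ?_ fun z hz => (Real.rpow_pos_of_pos hz _).ne'
  exact continuousOn_id.rpow_const fun z hz => .inl (ne_of_gt hz)

theorem continuousOn_rieszFellerLeft (hP : Continuous P) :
    ContinuousOn (rieszFellerLeft α P x) (Ioi 0) := by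
  unfold rieszFellerLeft
  refine ContinuousOn.div (by fun_prop) ?_ fun z hz => (Real.rpow_pos_of_pos hz _).ne'
  exact continuousOn_id.rpow_const fun z hz => .inl (ne_of_gt hz)

/-- A nonnegative function with zero integral vanishes a.e.; continuity on an open set removes the
exceptional set. -/
theorem eqOn_of_setIntegral_le {s : Set ℝ} (hs : IsOpen s) {g h : ℝ → ℝ}
    (hg : ContinuousOn g s) (hh : ContinuousOn h s) (hgi : IntegrableOn g s)
    (hhi : IntegrableOn h s) (hle : ∀ z ∈ s, g z ≤ h z)
    (hint : ∫ z in s, h z ≤ ∫ z in s, g z) : EqOn g h s := by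
  have h0 : ∫ z in s, (h z - g z) = 0 := by
    refine le_antisymm ?_ (setIntegral_nonneg hs.measurableSet fun z hz => sub_nonneg.2 (hle z hz))
    rw [integral_sub hhi hgi]
    linarith
  have hae : (fun z => h z - g z) =ᵐ[volume.restrict s] 0 :=
    (setIntegral_eq_zero_iff_of_nonneg_ae
      ((ae_restrict_iff' hs.measurableSet).2 (.of_forall fun z hz => sub_nonneg.2 (hle z hz)))
      (hhi.sub hgi)).1 h0
  have := Measure.eqOn_open_of_ae_eq hae hs (hh.sub hg) continuousOn_const
  intro z hz
  have := this hz
  simp only [Pi.zero_apply] at this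
  linarith

/-- Strong maximum principle for `α < 2`: two ordered functions that touch at `x`, where the
operators agree, coincide on the sides of `x` to which there are jumps. -/
theorem eq_of_rieszFeller_le (h1 : 1 < α) (h2 : α < 2) (hθ : |θ| ≤ min α (2 - α))
    (hPc : Continuous P) (hQc : Continuous Q)
    (hP : RieszFellerDefinedAt α P x) (hQ : RieszFellerDefinedAt α Q x)
    (hle : ∀ y, P y ≤ Q y) (heq : P x = Q x) (hD : rieszFeller α θ Q x ≤ rieszFeller α θ P x) :
    (0 < rieszFellerC₁ α θ → ∀ y, x ≤ y → P y = Q y) ∧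
      (0 < rieszFellerC₂ α θ → ∀ y, y ≤ x → P y = Q y) := by
  have hmin : ∀ y, Q x - P x ≤ Q y - P y := fun y => by linarith [hle y]
  have hd := deriv_eq_of_sub_min hP hQ hmin
  unfold RieszFellerDefinedAt at hP hQ
  unfold rieszFeller at hD
  rw [if_neg h2.ne] at hP hQ
  rw [if_neg h2.ne, if_neg h2.ne] at hD
  have hRle : ∀ z ∈ Ioi (0 : ℝ), rieszFellerRight α P x z ≤ rieszFellerRight α Q x z :=
    fun z hz => rieszFellerRight_le_of_sub_min hd hmin hz
  have hLle : ∀ z ∈ Ioi (0 : ℝ), rieszFellerLeft α P x z ≤ rieszFellerLeft α Q x z :=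
    fun z hz => rieszFellerLeft_le_of_sub_min hd hmin hz
  have hR := setIntegral_mono_on hP.2.1 hQ.2.1 measurableSet_Ioi hRle
  have hL := setIntegral_mono_on hP.2.2 hQ.2.2 measurableSet_Ioi hLle
  -- Both weighted integrals are ordered one way and `hD` orders their sum the other way, so each is
  -- an equality; a positive weight then cancels.
  have hR' := mul_le_mul_of_nonneg_left hR (rieszFellerC₁_nonneg h1 hθ)
  have hL' := mul_le_mul_of_nonneg_left hL (rieszFellerC₂_nonneg h1 hθ)
  refine ⟨fun hc y hy => ?_, fun hc y hy => ?_⟩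
  · rcases hy.eq_or_lt with rfl | hy
    · exact heq
    have hE := eqOn_of_setIntegral_le isOpen_Ioi (continuousOn_rieszFellerRight hPc)
      (continuousOn_rieszFellerRight hQc) hP.2.1 hQ.2.1 hRle
      (le_of_mul_le_mul_left (by linarith) hc) (show y - x ∈ Ioi 0 from sub_pos.2 hy)
    have hz : (y - x) ^ (1 + α) ≠ 0 := (Real.rpow_pos_of_pos (sub_pos.2 hy) _).ne'
    simp only [rieszFellerRight, add_sub_cancel, hd, heq, div_left_inj' hz] at hE
    linarith
  · rcases hy.eq_or_lt with rfl | hy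
    · exact heq
    have hE := eqOn_of_setIntegral_le isOpen_Ioi (continuousOn_rieszFellerLeft hPc)
      (continuousOn_rieszFellerLeft hQc) hP.2.2 hQ.2.2 hLle
      (le_of_mul_le_mul_left (by linarith) hc) (show x - y ∈ Ioi 0 from sub_pos.2 hy)
    have hz : (x - y) ^ (1 + α) ≠ 0 := (Real.rpow_pos_of_pos (sub_pos.2 hy) _).ne'
    simp only [rieszFellerLeft, sub_sub_cancel, hd, heq, div_left_inj' hz] at hE
    linarith

end Minimum

/-! ### Bistability, comparison and sliding. -/

theorem exists_strictAntiOn_of_deriv_neg {f : ℝ → ℝ} (hf : ContDiff ℝ 1 f) {a : ℝ}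
    (ha : deriv f a < 0) : ∃ δ > 0, StrictAntiOn f (Icc (a - δ) (a + δ)) := by
  have hc : Continuous (deriv f) := hf.continuous_deriv le_rfl
  obtain ⟨ε, hε, hball⟩ := Metric.eventually_nhds_iff_ball.1 (hc.continuousAt.eventually_lt_const ha)
  refine ⟨ε / 2, by positivity, strictAntiOn_of_deriv_neg (convex_Icc _ _)
    hf.continuous.continuousOn fun y hy => hball y ?_⟩
  rw [interior_Icc] at hy
  rw [Metric.mem_ball, Real.dist_eq, abs_lt]
  constructor <;> linarith [hy.1, hy.2]

/-- A bistable nonlinearity is strictly decreasing near both stable states. -/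
theorem IsBistable.exists_strictAntiOn {f : ℝ → ℝ} (hf : IsBistable f) :
    ∃ δ, 0 < δ ∧ StrictAntiOn f (Icc 0 δ) ∧ StrictAntiOn f (Icc (1 - δ) 1) := by
  obtain ⟨d₀, h₀, a₀⟩ := exists_strictAntiOn_of_deriv_neg hf.contDiff hf.deriv_zero
  obtain ⟨d₁, h₁, a₁⟩ := exists_strictAntiOn_of_deriv_neg hf.contDiff hf.deriv_one
  refine ⟨min d₀ d₁, by positivity, a₀.mono ?_, a₁.mono ?_⟩
  · have : min d₀ d₁ ≤ d₀ := min_le_left _ _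
    exact Icc_subset_Icc (by linarith) (by linarith)
  · have : min d₀ d₁ ≤ d₁ := min_le_right _ _
    exact Icc_subset_Icc (by linarith) (by linarith)

theorem exists_forall_le_of_tendsto_zero {g : ℝ → ℝ} (hg : Continuous g)
    (hb : Tendsto g atBot (𝓝 0)) (ht : Tendsto g atTop (𝓝 0)) {y : ℝ} (hy : g y < 0) :
    ∃ x, g x < 0 ∧ ∀ z, g x ≤ g z := by
  have hco : Tendsto g (cocompact ℝ) (𝓝 0) := by
    rw [cocompact_eq_atBot_atTop]
    exact hb.sup ht
  obtain ⟨x, hx⟩ := hg.exists_forall_le' y ((hco.eventually_const_lt hy).mono fun _ => le_of_lt)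
  exact ⟨x, (hx y).trans_lt hy, hx⟩

/-- Comparison principle: a subsolution `P` and a supersolution `Q` with the same limits are ordered
if, wherever the order fails, both lie in one of the intervals on which `f` decreases. -/
theorem le_of_subsolution_supersolution {α θ : ℝ} (h1 : 1 < α) (hθ : |θ| ≤ min α (2 - α))
    {f : ℝ → ℝ} {δ k : ℝ} (hf₀ : StrictAntiOn f (Icc 0 δ)) (hf₁ : StrictAntiOn f (Icc (1 - δ) 1))
    {P Q : ℝ → ℝ} (hPc : Continuous P) (hQc : Continuous Q)
    (hPb : Tendsto P atBot (𝓝 0)) (hPt : Tendsto P atTop (𝓝 1))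
    (hQb : Tendsto Q atBot (𝓝 0)) (hQt : Tendsto Q atTop (𝓝 1))
    (hP1 : ∀ x, P x ≤ 1) (hQ0 : ∀ x, 0 ≤ Q x)
    (hP : ∀ x, RieszFellerDefinedAt α P x) (hQ : ∀ x, RieszFellerDefinedAt α Q x)
    (hPs : ∀ x, 0 ≤ rieszFeller α θ P x + k * deriv P x + f (P x))
    (hQs : ∀ x, rieszFeller α θ Q x + k * deriv Q x + f (Q x) ≤ 0)
    (hend : ∀ x, Q x < P x → P x ≤ δ ∨ 1 - δ ≤ Q x) (x : ℝ) : P x ≤ Q x := by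
  by_contra! hlt
  have hb : Tendsto (fun x => Q x - P x) atBot (𝓝 0) := by simpa using hQb.sub hPb
  have ht : Tendsto (fun x => Q x - P x) atTop (𝓝 0) := by simpa using hQt.sub hPt
  obtain ⟨y, hy, hmin⟩ := exists_forall_le_of_tendsto_zero (hQc.sub hPc) hb ht (sub_neg.2 hlt)
  have hy' : Q y < P y := sub_neg.1 hy
  have hd := deriv_eq_of_sub_min (hP y) (hQ y) hmin
  have hD := rieszFeller_le_of_sub_min h1 hθ (hP y) (hQ y) hmin
  have hff : f (Q y) ≤ f (P y) := by
    have := hPs y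
    rw [hd] at this
    linarith [hQs y]
  rcases hend y hy' with h | h
  · exact absurd (hf₀ ⟨hQ0 y, hy'.le.trans h⟩ ⟨(hQ0 y).trans hy'.le, h⟩ hy') hff.not_gt
  · exact absurd (hf₁ ⟨h, hy'.le.trans (hP1 y)⟩ ⟨h.trans hy'.le, hP1 y⟩ hy') hff.not_gt

/-- Sliding: for an increasing family `P` and a decreasing family `Q` that obey the comparison
principle there is a parameter at which `P ≤ Q` and the two graphs touch. -/
theorem exists_touching {P Q : ℝ → ℝ → ℝ} {δ : ℝ} (hδ : 0 < δ)
    (hPc : Continuous fun p : ℝ × ℝ => P p.1 p.2) (hQc : Continuous fun p : ℝ × ℝ => Q p.1 p.2)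
    (hPm : ∀ x, Monotone fun s => P s x) (hQm : ∀ x, Antitone fun s => Q s x)
    (hPb : ∀ s, Tendsto (P s) atBot (𝓝 0)) (hQt : ∀ s, Tendsto (Q s) atTop (𝓝 1))
    (hcomp : ∀ s, (∀ x, Q s x < P s x → P s x ≤ δ ∨ 1 - δ ≤ Q s x) → ∀ x, P s x ≤ Q s x)
    {s₀ : ℝ} (hs₀ : ∀ x, P s₀ x ≤ δ ∨ 1 - δ ≤ Q s₀ x) {s₁ x₁ : ℝ} (hs₁ : Q s₁ x₁ < P s₁ x₁) :
    ∃ s x, (∀ y, P s y ≤ Q s y) ∧ P s x = Q s x := by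
  set S : Set ℝ := {s | ∀ x, P s x ≤ Q s x} with hS
  have hne : S.Nonempty := ⟨s₀, hcomp s₀ fun x _ => hs₀ x⟩
  have hbdd : BddAbove S := by
    refine ⟨s₁, fun s hs => le_of_not_gt fun hlt => ?_⟩
    exact absurd (hs x₁) (((hQm x₁ hlt.le).trans_lt hs₁).trans_le (hPm x₁ hlt.le)).not_ge
  have hclosed : IsClosed S := by
    simp only [hS, ofPred_forall]
    exact isClosed_iInter fun x => isClosed_le
      (hPc.comp (continuous_id.prodMk continuous_const))
      (hQc.comp (continuous_id.prodMk continuous_const))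
  have hmem : sSup S ∈ S := hclosed.csSup_mem hne hbdd
  set t := sSup S
  by_contra! hno
  have hlt : ∀ x, P t x < Q t x := fun x => lt_of_le_of_ne (hmem x) (hno t x hmem)
  -- By monotonicity in the parameter, tails chosen at `t + 1` serve every `s < t + 1`. Strict order
  -- on the compact middle survives a small increase of `s`, which contradicts the supremum.
  obtain ⟨A, hA⟩ := eventually_atBot.1 ((hPb (t + 1)).eventually_lt_const hδ)
  obtain ⟨B, hB⟩ := eventually_atTop.1
    ((hQt (t + 1)).eventually_const_lt (show 1 - δ < 1 by linarith))
  have hev : ∀ᶠ s in 𝓝 t, ∀ x ∈ Icc A B, P s x < Q s x :=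
    isCompact_Icc.eventually_forall_of_forall_eventually fun x _ =>
      (isOpen_lt hPc hQc).mem_nhds (show P t x < Q t x from hlt x)
  have hev' : ∀ᶠ s in 𝓝[>] t, s < t + 1 := nhdsWithin_le_nhds (eventually_lt_nhds (by linarith))
  have hevK : ∀ᶠ s in 𝓝[>] t, ∀ x ∈ Icc A B, P s x < Q s x := nhdsWithin_le_nhds hev
  obtain ⟨s, ⟨hsK, hs1⟩, hts⟩ := ((hevK.and hev').and self_mem_nhdsWithin).exists
  have hsS : s ∈ S := by
    refine hcomp s fun x hx => ?_
    rcases le_or_gt x A with h | h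
    · exact .inl ((hPm x hs1.le).trans (hA x h).le)
    rcases le_or_gt B x with h' | h'
    · exact .inr ((hB x h').le.trans (hQm x hs1.le))
    · exact absurd (hsK x ⟨h.le, h'.le⟩) hx.not_gt
  exact absurd (le_csSup hbdd hsS) (not_le.2 hts)

/-- `U` is pushed right until it is still small wherever `V` is not yet near `1`. -/
theorem exists_shift_add_tails {U V : ℝ → ℝ} {δ : ℝ} (hδ : 0 < δ) (hUm : Monotone U)
    (hUb : Tendsto U atBot (𝓝 0)) (hVt : Tendsto V atTop (𝓝 1)) :
    ∃ s, ∀ x, U (x + s) ≤ δ ∨ 1 - δ ≤ V x := by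
  obtain ⟨A, hA⟩ := eventually_atBot.1 (hUb.eventually_lt_const hδ)
  obtain ⟨B, hB⟩ := eventually_atTop.1 (hVt.eventually_const_lt (show 1 - δ < 1 by linarith))
  refine ⟨A - B, fun x => (le_total x B).imp (fun h => ?_) fun h => (hB x h).le⟩
  exact (hUm (by linarith)).trans (hA A le_rfl).le

theorem exists_shift_sub_tails {U V : ℝ → ℝ} {δ : ℝ} (hδ : 0 < δ) (hUm : Monotone U)
    (hUt : Tendsto U atTop (𝓝 1)) (hVb : Tendsto V atBot (𝓝 0)) :
    ∃ s, ∀ x, V x ≤ δ ∨ 1 - δ ≤ U (x - s) := by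
  obtain ⟨A, hA⟩ := eventually_atBot.1 (hVb.eventually_lt_const hδ)
  obtain ⟨B, hB⟩ := eventually_atTop.1 (hUt.eventually_const_lt (show 1 - δ < 1 by linarith))
  refine ⟨A - B, fun x => (le_total x A).imp (fun h => (hA x h).le) fun h => ?_⟩
  exact (hB B le_rfl).le.trans (hUm (by linarith))

/-! ### Contact between two waves and comparison of speeds. -/

section Waves

variable {α θ : ℝ} {f U V : ℝ → ℝ} {c c' : ℝ}

theorem IsTravelingWave.continuous {a b : ℝ} (hU : IsTravelingWave α θ f a b U c) :
    Continuous U :=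
  continuous_iff_continuousAt.2 fun x => (hU.definedAt x).differentiableAt.continuousAt

theorem IsTravelingWave.mem_Ioo (hU : IsTravelingWave α θ f 0 1 U c) (hUm : StrictMono U) (x : ℝ) :
    0 < U x ∧ U x < 1 :=
  ⟨(hUm.monotone.le_of_tendsto hU.tendsto_atBot (x - 1)).trans_lt (hUm (by linarith)),
    (hUm (show x < x + 1 by linarith)).trans_le (hUm.monotone.ge_of_tendsto hU.tendsto_atTop _)⟩

/-- The translates of a wave are traveling-wave profiles. -/
theorem IsTravelingWave.profile_translate {a b : ℝ} (hU : IsTravelingWave α θ f a b U c) (s x : ℝ) :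
    rieszFeller α θ (fun y => U (y + s)) x + c * deriv (fun y => U (y + s)) x + f (U (x + s)) = 0 := by
  rw [rieszFeller_translate, deriv_comp_translate]
  exact hU.profile (x + s)

theorem exists_touching_below (h1 : 1 < α) (hθ : |θ| ≤ min α (2 - α)) (hf : IsBistable f)
    (hU : IsTravelingWave α θ f 0 1 U c) (hU_pos : ∀ ξ, 0 < deriv U ξ)
    (hV : IsTravelingWave α θ f 0 1 V c') (hV0 : ∀ ξ, 0 ≤ V ξ) (hcc : c ≤ c') :
    ∃ s x, (∀ y, U (y + s) ≤ V y) ∧ U (x + s) = V x := by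
  obtain ⟨δ, hδ, hf₀, hf₁⟩ := hf.exists_strictAntiOn
  have hUm : StrictMono U := strictMono_of_deriv_pos hU_pos
  have hUc := hU.continuous
  have hVc := hV.continuous
  obtain ⟨s₀, hs₀⟩ := exists_shift_add_tails hδ hUm.monotone hU.tendsto_atBot hV.tendsto_atTop
  -- The shift `-x₁` puts the value `U 0` above `V x₁`, so the order fails there and sliding must
  -- stop.
  obtain ⟨x₁, hx₁⟩ := (hV.tendsto_atBot.eventually_lt_const (hU.mem_Ioo hUm 0).1).exists
  refine exists_touching (P := fun s x => U (x + s)) (Q := fun _ x => V x) hδ (by fun_prop)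
    (by fun_prop) (fun x s t h => hUm.monotone (by linarith)) (fun x s t _ => le_rfl)
    (fun s => hU.tendsto_atBot.comp (tendsto_atBot_add_const_right _ _ tendsto_id))
    (fun _ => hV.tendsto_atTop) (fun s hend => ?_) hs₀ (s₁ := -x₁) (x₁ := x₁) (by simpa using hx₁)
  refine le_of_subsolution_supersolution h1 hθ hf₀ hf₁ (k := c') (by fun_prop) hVc
    (hU.tendsto_atBot.comp (tendsto_atBot_add_const_right _ _ tendsto_id))
    (hU.tendsto_atTop.comp (tendsto_atTop_add_const_right _ _ tendsto_id))
    hV.tendsto_atBot hV.tendsto_atTop (fun x => (hU.mem_Ioo hUm _).2.le) hV0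
    (fun x => (hU.definedAt _).translate) hV.definedAt (fun x => ?_) (fun x => (hV.profile x).le)
    hend
  -- At speed `c'` the residual of the translate is `(c' - c) U' ≥ 0`.
  have h := hU.profile_translate s x
  have hp : 0 < deriv (fun y => U (y + s)) x := by
    rw [deriv_comp_translate]
    exact hU_pos _
  nlinarith

theorem exists_touching_above (h1 : 1 < α) (hθ : |θ| ≤ min α (2 - α)) (hf : IsBistable f)
    (hU : IsTravelingWave α θ f 0 1 U c) (hU_pos : ∀ ξ, 0 < deriv U ξ)
    (hV : IsTravelingWave α θ f 0 1 V c') (hV1 : ∀ ξ, V ξ ≤ 1) (hcc : c' ≤ c) :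
    ∃ s x, (∀ y, V y ≤ U (y + s)) ∧ V x = U (x + s) := by
  obtain ⟨δ, hδ, hf₀, hf₁⟩ := hf.exists_strictAntiOn
  have hUm : StrictMono U := strictMono_of_deriv_pos hU_pos
  have hUc := hU.continuous
  have hVc := hV.continuous
  obtain ⟨s₀, hs₀⟩ := exists_shift_sub_tails hδ hUm.monotone hU.tendsto_atTop hV.tendsto_atBot
  obtain ⟨x₁, hx₁⟩ := (hV.tendsto_atTop.eventually_const_lt (hU.mem_Ioo hUm 0).2).exists
  -- The sign makes the upper family decrease in its parameter, as `exists_touching` requires.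
  suffices h : ∃ s x, (∀ y, V y ≤ U (y - s)) ∧ V x = U (x - s) by
    obtain ⟨s, x, h⟩ := h
    exact ⟨-s, x, by simpa only [sub_eq_add_neg] using h⟩
  refine exists_touching (P := fun _ x => V x) (Q := fun s x => U (x - s)) hδ (by fun_prop)
    (by fun_prop) (fun x s t _ => le_rfl) (fun x s t h => hUm.monotone (by linarith))
    (fun _ => hV.tendsto_atBot)
    (fun s => hU.tendsto_atTop.comp (tendsto_atTop_add_const_right _ (-s) tendsto_id))
    (fun s hend => ?_) hs₀ (s₁ := x₁) (x₁ := x₁) (by simpa using hx₁)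
  simp only [sub_eq_add_neg] at hend ⊢
  refine le_of_subsolution_supersolution h1 hθ hf₀ hf₁ (k := c') hVc (by fun_prop)
    hV.tendsto_atBot hV.tendsto_atTop
    (hU.tendsto_atBot.comp (tendsto_atBot_add_const_right _ _ tendsto_id))
    (hU.tendsto_atTop.comp (tendsto_atTop_add_const_right _ _ tendsto_id))
    hV1 (fun x => (hU.mem_Ioo hUm _).1.le) hV.definedAt
    (fun x => (hU.definedAt _).translate) (fun x => (hV.profile x).ge) (fun x => ?_) hend
  have h := hU.profile_translate (-s) x
  have hp : 0 < deriv (fun y => U (y + -s)) x := by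
    rw [deriv_comp_translate]
    exact hU_pos _
  nlinarith

/-- A wave touching a translate of the monotone wave from above cannot be faster. -/
theorem speed_le_of_touching_below (h1 : 1 < α) (hθ : |θ| ≤ min α (2 - α))
    (hU : IsTravelingWave α θ f 0 1 U c) (hU_pos : ∀ ξ, 0 < deriv U ξ)
    (hV : IsTravelingWave α θ f 0 1 V c') {s x : ℝ} (hle : ∀ y, U (y + s) ≤ V y)
    (heq : U (x + s) = V x) : c' ≤ c := by
  have hmin : ∀ y, V x - (fun y => U (y + s)) x ≤ V y - (fun y => U (y + s)) y :=
    fun y => by simp only; linarith [hle y]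
  have hUs : RieszFellerDefinedAt α (fun y => U (y + s)) x := (hU.definedAt _).translate
  have hd := deriv_eq_of_sub_min hUs (hV.definedAt x) hmin
  have hD := rieszFeller_le_of_sub_min h1 hθ hUs (hV.definedAt x) hmin
  have h := hU.profile_translate s x
  have h' := hV.profile x
  rw [heq, hd] at h
  have hp : 0 < deriv V x := by
    rw [← hd, deriv_comp_translate]
    exact hU_pos _
  nlinarith

theorem speed_ge_of_touching_above (h1 : 1 < α) (hθ : |θ| ≤ min α (2 - α))
    (hU : IsTravelingWave α θ f 0 1 U c) (hU_pos : ∀ ξ, 0 < deriv U ξ)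
    (hV : IsTravelingWave α θ f 0 1 V c') {s x : ℝ} (hle : ∀ y, V y ≤ U (y + s))
    (heq : V x = U (x + s)) : c ≤ c' := by
  have hmin : ∀ y, (fun y => U (y + s)) x - V x ≤ (fun y => U (y + s)) y - V y :=
    fun y => by simp only; linarith [hle y]
  have hUs : RieszFellerDefinedAt α (fun y => U (y + s)) x := (hU.definedAt _).translate
  have hd := deriv_eq_of_sub_min (hV.definedAt x) hUs hmin
  have hD := rieszFeller_le_of_sub_min h1 hθ (hV.definedAt x) hUs hmin
  have h := hU.profile_translate s x
  have h' := hV.profile x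
  rw [← heq, ← hd] at h
  have hp : 0 < deriv V x := by
    rw [hd, deriv_comp_translate]
    exact hU_pos _
  nlinarith

end Waves

/-! ### The local case `α = 2`. -/

/-- Uniqueness for `y'' + c y' + f(y) = 0` with initial data at an arbitrary point. -/
theorem eq_of_second_order_ode {f : ℝ → ℝ} (hf : ContDiff ℝ 1 f) {c : ℝ} {P Q : ℝ → ℝ}
    (hP01 : ∀ x, P x ∈ Icc (0 : ℝ) 1) (hQ01 : ∀ x, Q x ∈ Icc (0 : ℝ) 1)
    (hP : ∀ x, HasDerivAt P (deriv P x) x) (hQ : ∀ x, HasDerivAt Q (deriv Q x) x)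
    (hP2 : ∀ x, HasDerivAt (deriv P) (-(c * deriv P x) - f (P x)) x)
    (hQ2 : ∀ x, HasDerivAt (deriv Q) (-(c * deriv Q x) - f (Q x)) x)
    {x₀ : ℝ} (h0 : P x₀ = Q x₀) (h0' : deriv P x₀ = deriv Q x₀) : P = Q := by
  -- `f` need not be globally Lipschitz, so uniqueness is applied in the strip where the profiles
  -- take values in `[0, 1]`.
  obtain ⟨K, hK⟩ := (hf.contDiffOn (s := Icc (0 : ℝ) 1)).exists_lipschitzOnWith one_ne_zero
    (convex_Icc _ _) isCompact_Icc
  have hlin : LipschitzWith (1 + ‖c‖₊) fun p : ℝ × ℝ => c * p.2 := by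
    refine LipschitzWith.of_dist_le_mul fun p q => ?_
    rw [Real.dist_eq, ← mul_sub, abs_mul, ← Real.dist_eq]
    have h2 : dist p.2 q.2 ≤ dist p q := le_max_right _ _
    have : |c| * dist p.2 q.2 ≤ |c| * dist p q := by gcongr
    simp only [NNReal.coe_add, NNReal.coe_one, coe_nnnorm, Real.norm_eq_abs]
    nlinarith [dist_nonneg (x := p) (y := q)]
  set s : Set (ℝ × ℝ) := {p | p.1 ∈ Icc (0 : ℝ) 1}
  have hfl : LipschitzOnWith (K * 1) (fun p : ℝ × ℝ => f p.1) s :=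
    hK.comp LipschitzWith.prod_fst.lipschitzOnWith fun p hp => hp
  have hv := (LipschitzWith.prod_snd.lipschitzOnWith (s := s)).prodMk
    ((hlin.neg.lipschitzOnWith (s := s)).sub hfl)
  have key := ODE_solution_unique_univ (v := fun _ p => (p.2, -(c * p.2) - f p.1)) (s := fun _ => s)
    (f := fun x => (P x, deriv P x)) (g := fun x => (Q x, deriv Q x)) (t₀ := x₀)
    (fun _ => hv) (fun x => ⟨(hP x).prodMk (hP2 x), hP01 x⟩)
    (fun x => ⟨(hQ x).prodMk (hQ2 x), hQ01 x⟩) (by simp [h0, h0'])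
  exact funext fun x => congrArg Prod.fst (congrFun key x)

theorem IsTravelingWave.hasDerivAt_deriv {θ : ℝ} {f : ℝ → ℝ} {a b : ℝ} {U : ℝ → ℝ} {c : ℝ}
    (hU : IsTravelingWave 2 θ f a b U c) (x : ℝ) :
    HasDerivAt (deriv U) (-(c * deriv U x) - f (U x)) x := by
  have hd := hU.definedAt x
  have hp := hU.profile x
  simp only [RieszFellerDefinedAt, if_true] at hd
  simp only [rieszFeller, if_true] at hp
  have h := hd.2.hasDerivAt
  rwa [show deriv (deriv U) x = -(c * deriv U x) - f (U x) by linarith] at h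

/-! ### Uniqueness of speed and profile. -/

theorem mainTheorem4 (α θ : ℝ) (hα₁ : 1 < α) (hα₂ : α ≤ 2) (hθ : |θ| ≤ min α (2 - α))
    (f : ℝ → ℝ) (hf : IsBistable f)
    (U : ℝ → ℝ) (c : ℝ) (hU : IsTravelingWave α θ f 0 1 U c)
    (hU_C1 : ContDiff ℝ 1 U) (hU_pos : ∀ ξ, 0 < deriv U ξ)
    (hU_lim : Tendsto (deriv U) (cocompact ℝ) (𝓝 0))
    (V : ℝ → ℝ) (c' : ℝ) (hV : IsTravelingWave α θ f 0 1 V c')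
    (hV_cont : Continuous V) (hV_mem : ∀ ξ, 0 ≤ V ξ ∧ V ξ ≤ 1) :
    c' = c ∧ ∃ ξ₀ : ℝ, ∀ ξ, V ξ = U (ξ + ξ₀) := by
  have hUm : StrictMono U := strictMono_of_deriv_pos hU_pos
  have hV0 := fun ξ => (hV_mem ξ).1
  have hV1 := fun ξ => (hV_mem ξ).2
  have hc : c' = c := by
    rcases le_total c c' with h | h
    · obtain ⟨s, x, hle, heq⟩ := exists_touching_below hα₁ hθ hf hU hU_pos hV hV0 h
      exact (speed_le_of_touching_below hα₁ hθ hU hU_pos hV hle heq).antisymm h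
    · obtain ⟨s, x, hle, heq⟩ := exists_touching_above hα₁ hθ hf hU hU_pos hV hV1 h
      exact h.antisymm (speed_ge_of_touching_above hα₁ hθ hU hU_pos hV hle heq)
  subst hc
  refine ⟨rfl, ?_⟩
  obtain ⟨s, x, hle, heq⟩ := exists_touching_below hα₁ hθ hf hU hU_pos hV hV0 le_rfl
  have hUs : ∀ y, RieszFellerDefinedAt α (fun y => U (y + s)) y :=
    fun y => (hU.definedAt _).translate
  have hmin : ∀ y, V x - (fun y => U (y + s)) x ≤ V y - (fun y => U (y + s)) y :=
    fun y => by simp only; linarith [hle y]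
  have hd := deriv_eq_of_sub_min (hUs x) (hV.definedAt x) hmin
  rcases hα₂.eq_or_lt with rfl | hα
  · refine ⟨s, fun ξ => congrFun (eq_of_second_order_ode hf.contDiff (c := c') (x₀ := x) hV_mem
      (fun y => ?_) (fun y => (hV.definedAt y).differentiableAt.hasDerivAt)
      (fun y => (hUs y).differentiableAt.hasDerivAt) hV.hasDerivAt_deriv (fun y => ?_)
      heq.symm hd.symm) ξ⟩
    · exact ⟨(hU.mem_Ioo hUm _).1.le, (hU.mem_Ioo hUm _).2.le⟩
    · rw [deriv_comp_translate]
      exact (hU.hasDerivAt_deriv (y + s)).comp_add_const y s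
  -- One contact may give equality only on a half-line, so a second contact from the other side is
  -- needed.
  · obtain ⟨t, w, hle', heq'⟩ := exists_touching_above hα₁ hθ hf hU hU_pos hV hV1 le_rfl
    have hUt : RieszFellerDefinedAt α (fun y => U (y + t)) w := (hU.definedAt _).translate
    have hmin' : ∀ y, (fun y => U (y + t)) w - V w ≤ (fun y => U (y + t)) y - V y :=
      fun y => by simp only; linarith [hle' y]
    have hd' := deriv_eq_of_sub_min (hV.definedAt w) hUt hmin'
    have hpU := hU.profile_translate s x
    have hpU' := hU.profile_translate t w
    have hpV := hV.profile x
    have hpV' := hV.profile w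
    rw [heq, hd] at hpU
    rw [← heq', ← hd'] at hpU'
    have hUc := hU.continuous
    obtain ⟨r₁, l₁⟩ := eq_of_rieszFeller_le (θ := θ) hα₁ hα hθ (by fun_prop) hV_cont (hUs x)
      (hV.definedAt x) hle heq (by linarith)
    obtain ⟨r₂, l₂⟩ := eq_of_rieszFeller_le (θ := θ) hα₁ hα hθ hV_cont (by fun_prop)
      (hV.definedAt w) hUt hle' heq' (by linarith)
    -- Both half-lines point in the direction of the available jumps, so they share `max x w` or
    -- `min x w`, where injectivity of `U` identifies the shifts.
    have hst : s = t := by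
      rcases rieszFellerC_pos_or_pos hα₁ hα hθ with h | h
      · have := hUm.injective
          ((r₁ h (max x w) (le_max_left _ _)).trans (r₂ h (max x w) (le_max_right _ _)))
        linarith
      · have := hUm.injective
          ((l₁ h (min x w) (min_le_left _ _)).trans (l₂ h (min x w) (min_le_right _ _)))
        linarith
    subst hst
    exact ⟨s, fun ξ => (hle' ξ).antisymm (hle ξ)⟩
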